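/- Let $A$ be a finite nonempty alphabet and $K$ a semiring. A series is a map $s:A^*\to K$; it is proper if $s(\varepsilon)=0$. For $w=w(0)\cdots w(n-1)\in A^*$ with $n\ge 1$, $w_{\ge 1}=w(1)\cdots w(n-1)$. LDL formulas $\psi$ over $A$ and path expressions $\theta$ are given by $$\psi::=true\mid p_a\mid\neg\psi\mid\psi\wedge\psi\mid\langle\theta\rangle\psi,\qquad \theta::=\phi\mid\psi?\mid\theta+\theta\mid\theta;\theta\mid\theta^+,$$ where $a\in A$ and $\phi$ ranges over the propositional formulas built from $true$ and the $p_a$ by $\neg$ and $\wedge$. For $w\in A^*$: $w\models true$; $w\models p_a$ iff $w\neq\varepsilon$ and $w(0)=a$; $\neg$ and $\wedge$ are as usual; $w\models\langle\phi\rangle\psi$ iff $w\models\phi$, $w\ne\varepsilon$ and $w_{\ge1}\models\psi$; $w\models\langle\psi_1?\rangle\psi_2$ iff $w\models\psi_1$ and $w\models\psi_2$; $w\models\langle\theta_1+\theta_2\rangle\psi$ iff $w\models\langle\theta_1\rangle\psi$ or $w\models\langle\theta_2\rangle\psi$; $w\models\langle\theta_1;\theta_2\rangle\psi$ iff $w=uv$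 for some $u,v$ with $u\models\langle\theta_1\rangle true$ and $v\models\langle\theta_2\rangle\psi$; $w\models\langle\theta^+\rangle\psi$ iff $w\models\langle\theta^n\rangle\psi$ for some $1\le n\le|w|$, where $\theta^1=\theta$ and $\theta^{n}=\theta^{n-1};\theta$. Weighted LDL formulas $\varphi$ over $A$ and $K$ and weighted path expressions $\rho$ are given by $$\varphi::=k\mid\psi\mid\varphi\oplus\varphi\mid\varphi\otimes\varphi\mid\langle\rho\rangle\varphi,\qquad \rho::=\phi\mid\varphi?\mid\rho\oplus\rho\mid\rho\cdot\rho\mid\rho^{\oplus},$$ where $k\in K$, $\psi$ is an LDL formula and $\phi$ is a propositional formula. The semantics of $\varphi$ is the series $\|\varphi\|$ with $\|k\|(w)=k$; $\|\psi\|(w)=1$ if $w\models\psi$ and $0$ otherwise; $\|\varphi_1\oplus\varphi_2\|(w)=\|\varphi_1\|(w)+\|\varphi_2\|(w)$; $\|\varphi_1\otimes\varphi_2\|(w)=\|\varphi_1\|(w)\,\|\varphi_2\|(w)$; $\|\langle\phi\rangle\varphi\|(w)=\|\phi\|(w)\,\|\varphi\|(w_{\ge1})$ for $w\neq\varepsilon$,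 and $\|\langle\phi\rangle\varphi\|(\varepsilon)=0$; $\|\langle\varphi_1?\rangle\varphi_2\|(w)=\|\varphi_1\|(w)\,\|\varphi_2\|(w)$; $\|\langle\rho_1\oplus\rho_2\rangle\varphi\|(w)=\|\langle\rho_1\rangle\varphi\|(w)+\|\langle\rho_2\rangle\varphi\|(w)$; $\|\langle\rho_1\cdot\rho_2\rangle\varphi\|(w)=\sum_{w=uv}\|\langle\rho_1\rangle true\|(u)\,\|\langle\rho_2\rangle\varphi\|(v)$; and $\|\langle\rho^{\oplus}\rangle\varphi\|(w)=\sum_{n\ge1}\|\langle\rho^n\rangle\varphi\|(w)$, where $\rho^1=\rho$ and $\rho^n=\rho^{n-1}\cdot\rho$. The last clause requires $\|\langle\rho\rangle true\|$ to be proper (the sum is then finite); the semantics of $\varphi$ is defined if this requirement is met at every iteration $\rho^{\oplus}$ occurring in $\varphi$. A series is LDL-definable if it equals $\|\varphi\|$ for a weighted LDL formula $\varphi$ whose semantics is defined. A weighted automaton over $A$ and $K$ consists of a finite set $Q$ of states and weights $in:Q\to K$, $wt:Q\times A\times Q\to K$, $ter:Q\to K$. It accepts the series $$w=a_1\cdots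 a_n\ \mapsto\sum_{(q_0,\dots,q_n)\in Q^{n+1}}in(q_0)\Big(\prod_{i=1}^n wt(q_{i-1},a_i,q_i)\Big)ter(q_n).$$ A series is recognizable if it is accepted by some weighted automaton. **Corollary.** Let $K$ be a commutative semiring and $A$ a finite nonempty alphabet. Then a series $s:A^*\to K$ is LDL-definable if and only if it is recognizable. -/

import Mathlib

namespace WeightedLDL

universe u v

/-! ### Formal series over finite words -/

/-- A series over the finite words `A*` (modelled as lists) with coefficients in `K`. -/
abbrev Series (A K : Type*) := List A → K

/-- A series is proper if its value at the empty word is `0`. -/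
def Proper {A K : Type*} [Semiring K] (s : Series A K) : Prop := s [] = 0

/-- The Cauchy product `(s · r)(w) = ∑_{w = uv} s(u) r(v)`: the factorizations of `w` are
`w = (w.take i) ++ (w.drop i)` with `0 ≤ i ≤ |w|`. -/
def cauchy {A K : Type*} [Semiring K] (s r : Series A K) : Series A K := fun w =>
  ∑ i ∈ Finset.range (w.length + 1), s (w.take i) * r (w.drop i)

/-- The characteristic series `1_L` of a language `L`. -/
noncomputable def charSeries {A : Type*} (K : Type*) [Semiring K] (L : Set (List A)) :
    Series A K := L.indicator 1

/-! ### Propositional formulas and LDL -/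

/-- Propositional formulas over the atomic propositions `p_a`, `a ∈ A`. -/
inductive PropFormula (A : Type*)
  | tt : PropFormula A
  | atom (a : A) : PropFormula A
  | neg (φ : PropFormula A) : PropFormula A
  | and (φ₁ φ₂ : PropFormula A) : PropFormula A

/-- `w ⊨ φ`; the atom `p_a` holds at `w` iff `w` is nonempty with first letter `a`. -/
def PropFormula.Sat {A : Type*} : PropFormula A → List A → Prop
  | .tt, _ => True
  | .atom a, w => w.head? = some a
  | .neg φ, w => ¬ φ.Sat w
  | .and φ₁ φ₂, w => φ₁.Sat w ∧ φ₂.Sat w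

mutual

/-- LDL formulas `ψ ::= true | p_a | ¬ψ | ψ ∧ ψ | ⟨θ⟩ψ`. -/
inductive LDL (A : Type u)
  | tt : LDL A
  | atom (a : A) : LDL A
  | neg (ψ : LDL A) : LDL A
  | and (ψ₁ ψ₂ : LDL A) : LDL A
  | dia (θ : LDLPath A) (ψ : LDL A) : LDL A

/-- LDL path expressions `θ ::= φ | ψ? | θ + θ | θ ; θ | θ⁺`, with `φ` propositional. -/
inductive LDLPath (A : Type u)
  | prop (φ : PropFormula A) : LDLPath A
  | test (ψ : LDL A) : LDLPath A
  | plus (θ₁ θ₂ : LDLPath A) : LDLPath A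
  | seq (θ₁ θ₂ : LDLPath A) : LDLPath A
  | iter (θ : LDLPath A) : LDLPath A

end

/-- If `F` is the map sending the language of `ψ` to the language of `⟨θ⟩ψ`, then
`satPow F n` is the map sending the language of `ψ` to the language of `⟨θ^(n+1)⟩ψ`, where
`θ^1 = θ` and `θ^(n+1) = θ^n ; θ`
(see `LDLPath.sat_powSucc`). -/
def satPow {A : Type*} (F : (List A → Prop) → List A → Prop) :
    ℕ → (List A → Prop) → List A → Prop
  | 0, P => F P
  | n + 1, P => fun w =>
      ∃ u v, w = u ++ v ∧ satPow F n (fun _ => True) u ∧ F P v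

mutual

/-- The satisfaction relation `w ⊨ ψ` of LDL on finite words. -/
def LDL.Sat {A : Type*} : LDL A → List A → Prop
  | .tt => fun _ => True
  | .atom a => fun w => w.head? = some a
  | .neg ψ => fun w => ¬ LDL.Sat ψ w
  | .and ψ₁ ψ₂ => fun w => LDL.Sat ψ₁ w ∧ LDL.Sat ψ₂ w
  | .dia θ ψ => LDLPath.Sat θ (LDL.Sat ψ)

/-- `LDLPath.Sat θ P w` is `w ⊨ ⟨θ⟩ψ`, where `P` is the set of words satisfying `ψ`.
For propositional `φ`, `w ⊨ ⟨φ⟩ψ` iff `w ⊨ φ` and the suffix `w_{≥1}` exists and satisfies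
`ψ`. -/
def LDLPath.Sat {A : Type*} : LDLPath A → (List A → Prop) → List A → Prop
  | .prop φ => fun P w => φ.Sat w ∧ ∃ a v, w = a :: v ∧ P v
  | .test ψ => fun P w => LDL.Sat ψ w ∧ P w
  | .plus θ₁ θ₂ => fun P w => LDLPath.Sat θ₁ P w ∨ LDLPath.Sat θ₂ P w
  | .seq θ₁ θ₂ => fun P w =>
      ∃ u v, w = u ++ v ∧ LDLPath.Sat θ₁ (fun _ => True) u ∧ LDLPath.Sat θ₂ P v
  | .iter θ => fun P w => ∃ n, n + 1 ≤ w.length ∧ satPow (LDLPath.Sat θ) n P w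

end

/-- The path expression `θ^(n+1)`, where `θ^1 = θ` and `θ^(n+1) = θ^n ; θ`. -/
def LDLPath.powSucc {A : Type*} (θ : LDLPath A) : ℕ → LDLPath A
  | 0 => θ
  | n + 1 => .seq (θ.powSucc n) θ

theorem LDLPath.sat_powSucc {A : Type*} (θ : LDLPath A) (n : ℕ) :
    (θ.powSucc n).Sat = satPow θ.Sat n := by
  induction n with
  | zero => rfl
  | succ n ih =>
    funext P w
    simp only [LDLPath.powSucc, LDLPath.Sat, satPow, ih]

/-- `w ⊨ ⟨θ⁺⟩ψ` iff `w ⊨ ⟨θ^n⟩ψ` for some `1 ≤ n ≤ |w|`. -/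
theorem LDL.sat_dia_iter {A : Type*} (θ : LDLPath A) (ψ : LDL A) (w : List A) :
    (LDL.dia (.iter θ) ψ).Sat w ↔
      ∃ n, n + 1 ≤ w.length ∧ (LDL.dia (θ.powSucc n) ψ).Sat w := by
  simp only [LDL.Sat, LDLPath.sat_powSucc, LDLPath.Sat]

/-! ### Weighted LDL -/

mutual

/-- Weighted LDL formulas `φ ::= k | ψ | φ ⊕ φ | φ ⊗ φ | ⟨ρ⟩φ`, with `k ∈ K` and `ψ` an
LDL formula. -/
inductive WLDL (A : Type u) (K : Type v)
  | const (k : K) : WLDL A K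
  | ldl (ψ : LDL A) : WLDL A K
  | add (φ₁ φ₂ : WLDL A K) : WLDL A K
  | mul (φ₁ φ₂ : WLDL A K) : WLDL A K
  | dia (ρ : WLDLPath A K) (φ : WLDL A K) : WLDL A K

/-- Weighted path expressions `ρ ::= φ | φ? | ρ ⊕ ρ | ρ · ρ | ρ^⊕`; the first `φ` is
propositional and the second one is a weighted LDL formula. -/
inductive WLDLPath (A : Type u) (K : Type v)
  | prop (φ : PropFormula A) : WLDLPath A K
  | test (φ : WLDL A K) : WLDLPath A K
  | add (ρ₁ ρ₂ : WLDLPath A K) : WLDLPath A K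
  | mul (ρ₁ ρ₂ : WLDLPath A K) : WLDLPath A K
  | iter (ρ : WLDLPath A K) : WLDLPath A K

end

/-- If `F` is the map sending `‖φ‖` to `‖⟨ρ⟩φ‖`, then `semPow F n` is the map sending `‖φ‖`
to `‖⟨ρ^(n+1)⟩φ‖`, where `ρ^1 = ρ` and `ρ^(n+1) = ρ^n · ρ`
(see `WLDLPath.sem_powSucc`). -/
def semPow {A K : Type*} [Semiring K] (F : Series A K → Series A K) :
    ℕ → Series A K → Series A K
  | 0, s => F s
  | n + 1, s => cauchy (semPow F n (fun _ => 1)) (F s)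

mutual

/-- The semantics `‖φ‖` of a weighted LDL formula. It is meaningful for the formulas with
`φ.Defined`; for these the sum for `ρ^⊕` below has only finitely many nonzero terms. -/
noncomputable def WLDL.sem {A K : Type*} [Semiring K] : WLDL A K → Series A K
  | .const k => fun _ => k
  | .ldl ψ => charSeries K {w | ψ.Sat w}
  | .add φ₁ φ₂ => fun w => WLDL.sem φ₁ w + WLDL.sem φ₂ w
  | .mul φ₁ φ₂ => fun w => WLDL.sem φ₁ w * WLDL.sem φ₂ w
  | .dia ρ φ => WLDLPath.sem ρ (WLDL.sem φ)

/-- `WLDLPath.sem ρ ‖φ‖` is `‖⟨ρ⟩φ‖`. The constant series `1` is `‖true‖`. For propositional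
`φ'`, `‖⟨φ'⟩φ‖(w) = ‖φ'‖(w) · ‖φ‖(w_{≥1})` when the suffix `w_{≥1}` exists, that is when `w` is
nonempty, and the value is `0` at the empty word. -/
noncomputable def WLDLPath.sem {A K : Type*} [Semiring K] :
    WLDLPath A K → Series A K → Series A K
  | .prop φ => fun s w =>
      match w with
      | [] => 0
      | a :: v => charSeries K {w | φ.Sat w} (a :: v) * s v
  | .test φ => fun s w => WLDL.sem φ w * s w
  | .add ρ₁ ρ₂ => fun s w => WLDLPath.sem ρ₁ s w + WLDLPath.sem ρ₂ s w
  | .mul ρ₁ ρ₂ => fun s => cauchy (WLDLPath.sem ρ₁ (fun _ => 1)) (WLDLPath.sem ρ₂ s)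
  | .iter ρ => fun s w => ∑ᶠ n : ℕ, semPow (WLDLPath.sem ρ) n s w

end

mutual

/-- The semantics of `φ` is defined: every iteration `ρ^⊕` occurring in the weighted formula
`φ` is applied to a `ρ` for which `‖⟨ρ⟩true‖` is proper. -/
def WLDL.Defined {A K : Type*} [Semiring K] : WLDL A K → Prop
  | .const _ => True
  | .ldl _ => True
  | .add φ₁ φ₂ => WLDL.Defined φ₁ ∧ WLDL.Defined φ₂
  | .mul φ₁ φ₂ => WLDL.Defined φ₁ ∧ WLDL.Defined φ₂
  | .dia ρ φ => WLDLPath.Defined ρ ∧ WLDL.Defined φ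

/-- The corresponding condition on weighted path expressions. -/
def WLDLPath.Defined {A K : Type*} [Semiring K] : WLDLPath A K → Prop
  | .prop _ => True
  | .test φ => WLDL.Defined φ
  | .add ρ₁ ρ₂ => WLDLPath.Defined ρ₁ ∧ WLDLPath.Defined ρ₂
  | .mul ρ₁ ρ₂ => WLDLPath.Defined ρ₁ ∧ WLDLPath.Defined ρ₂
  | .iter ρ => WLDLPath.Defined ρ ∧ Proper (WLDL.dia ρ (.ldl .tt)).sem

end

/-- The weighted path expression `ρ^(n+1)`, where `ρ^1 = ρ` and `ρ^(n+1) = ρ^n · ρ`. -/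
def WLDLPath.powSucc {A K : Type*} (ρ : WLDLPath A K) : ℕ → WLDLPath A K
  | 0 => ρ
  | n + 1 => .mul (ρ.powSucc n) ρ

theorem WLDLPath.sem_powSucc {A K : Type*} [Semiring K] (ρ : WLDLPath A K) (n : ℕ) :
    (ρ.powSucc n).sem = semPow ρ.sem n := by
  induction n with
  | zero => rfl
  | succ n ih =>
    funext s
    simp only [WLDLPath.powSucc, WLDLPath.sem, semPow, ih]

/-- The semantics of `true` is the constant series `1`. -/
theorem WLDL.sem_true {A K : Type*} [Semiring K] :
    (WLDL.ldl LDL.tt : WLDL A K).sem = fun _ => 1 := by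
  funext w
  simp [WLDL.sem, charSeries, LDL.Sat]

/-- `‖⟨ρ₁ · ρ₂⟩φ‖(w) = ∑_{w = uv} ‖⟨ρ₁⟩true‖(u) · ‖⟨ρ₂⟩φ‖(v)`. -/
theorem WLDL.sem_dia_mul {A K : Type*} [Semiring K] (ρ₁ ρ₂ : WLDLPath A K) (φ : WLDL A K) :
    (WLDL.dia (.mul ρ₁ ρ₂) φ).sem =
      cauchy (WLDL.dia ρ₁ (.ldl .tt)).sem (WLDL.dia ρ₂ φ).sem := by
  have h := WLDL.sem_true (A := A) (K := K)
  simp only [WLDL.sem] at h ⊢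
  rw [h]
  simp only [WLDLPath.sem]

/-- `‖⟨ρ^⊕⟩φ‖(w) = ∑_{n ≥ 1} ‖⟨ρ^n⟩φ‖(w)`. -/
theorem WLDL.sem_dia_iter {A K : Type*} [Semiring K] (ρ : WLDLPath A K) (φ : WLDL A K)
    (w : List A) :
    (WLDL.dia (.iter ρ) φ).sem w = ∑ᶠ n : ℕ, (WLDL.dia (ρ.powSucc n) φ).sem w := by
  simp only [WLDL.sem, WLDLPath.sem_powSucc, WLDLPath.sem]

/-- A series is LDL-definable if it is the semantics of a weighted LDL formula (whose semantics
is defined). -/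
def LDLDefinable {A K : Type*} [Semiring K] (s : Series A K) : Prop :=
  ∃ φ : WLDL A K, φ.Defined ∧ s = φ.sem

/-! ### Weighted automata -/

/-- A weighted automaton over `A` and `K` with state set `Q`: initial, transition and final
weights. -/
structure WeightedAutomaton (A K Q : Type*) where
  init : Q → K
  wt : Q → A → Q → K
  final : Q → K

/-- The weight of the path `p` labelled by `w`: the initial weight of its first state, times the
product of its transition weights (in order), times the final weight of its last state. -/
def WeightedAutomaton.pathWeight {A K Q : Type*} [Semiring K] (M : WeightedAutomaton A K Q)
    (w : List A) (p : Fin (w.length + 1) → Q) : K :=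
  M.init (p 0) *
    (List.ofFn fun i : Fin w.length => M.wt (p i.castSucc) (w.get i) (p i.succ)).prod *
    M.final (p (Fin.last w.length))

/-- The series accepted by a weighted automaton: the value at `w` is the sum of the weights of
all paths labelled by `w`. -/
def WeightedAutomaton.behavior {A K Q : Type*} [Semiring K] [Fintype Q]
    (M : WeightedAutomaton A K Q) : Series A K :=
  fun w => ∑ p : Fin (w.length + 1) → Q, M.pathWeight w p

/-- A series is recognizable if it is accepted by a weighted automaton with finitely many
states. -/
def Recognizable {A K : Type*} [Semiring K] (s : Series A K) : Prop :=
  ∃ (n : ℕ) (M : WeightedAutomaton A K (Fin n)), s = M.behavior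

end WeightedLDL

-- Both directions pass through intrinsic descriptions of the series. Definable to recognizable: a
-- series lying in a finitely generated module of series closed under left quotients is recognizable
-- (`FinitelyStable.recognizable`). This property survives sums, pointwise products (by
-- commutativity of K), Cauchy products and solutions of X = pX + r with p proper; the semantics of
-- ρ^⊕ is such a solution (`finsum_semPow_eq`). The remaining base case is the characteristic series
-- of an LDL formula, which is stable because LDL languages are regular (`LDL.isRegular`). There the
-- delicate case is θ⁺, whose bound n ≤ |w| is analysed in `satPow_bounded_iff`. Recognizable to
-- definable: the behaviors from the states solve a linear system with proper coefficients, and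
-- Gaussian elimination (`LDLDefinable.of_linear_system`) expresses them by sums, products and
-- proper iterations, which weighted LDL imitates with tests φ?.

namespace WeightedLDL

/-! ### The Cauchy product -/

section Cauchy

variable {A K : Type*} [Semiring K]

/-- The left quotient `a⁻¹s` of a series by a letter, `(a⁻¹s)(w) = s(aw)`. -/
def quot (a : A) : Series A K →ₗ[K] Series A K := LinearMap.funLeft K K (List.cons a)

@[simp] theorem quot_apply (a : A) (s : Series A K) (w : List A) : quot a s w = s (a :: w) := rfl

@[simp] theorem cauchy_nil (s r : Series A K) : cauchy s r [] = s [] * r [] := by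
  simp [cauchy]

theorem cauchy_cons (s r : Series A K) (a : A) (w : List A) :
    cauchy s r (a :: w) = s [] * r (a :: w) + cauchy (quot a s) r w := by
  simp only [cauchy, List.length_cons]
  rw [Finset.sum_range_succ']
  simp [add_comm]

theorem cauchy_add_left (s t r : Series A K) : cauchy (s + t) r = cauchy s r + cauchy t r := by
  funext w; simp [cauchy, add_mul, Finset.sum_add_distrib]

theorem cauchy_add_right (s t r : Series A K) : cauchy s (t + r) = cauchy s t + cauchy s r := by
  funext w; simp [cauchy, mul_add, Finset.sum_add_distrib]

theorem cauchy_smul_left (k : K) (s r : Series A K) : cauchy (k • s) r = k • cauchy s r := by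
  funext w; simp [cauchy, mul_assoc, Finset.mul_sum]

theorem cauchy_sum_right {ι : Type*} (s : Series A K) (r : ι → Series A K) (S : Finset ι) :
    cauchy s (∑ i ∈ S, r i) = ∑ i ∈ S, cauchy s (r i) := by
  funext w
  simp only [cauchy, Finset.sum_apply, Finset.mul_sum]
  exact Finset.sum_comm

/-- Right Cauchy multiplication as a left linear map. -/
def cauchyRight (r : Series A K) : Series A K →ₗ[K] Series A K where
  toFun s := cauchy s r
  map_add' s t := cauchy_add_left s t r
  map_smul' k s := cauchy_smul_left k s r

@[simp] theorem cauchyRight_apply (r s : Series A K) : cauchyRight r s = cauchy s r := rfl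

theorem quot_cauchy (a : A) (s r : Series A K) :
    quot a (cauchy s r) = s [] • quot a r + cauchy (quot a s) r := by
  funext w; simp [cauchy_cons]

theorem cauchy_assoc (s t r : Series A K) : cauchy (cauchy s t) r = cauchy s (cauchy t r) := by
  funext w
  induction w generalizing s with
  | nil => simp [mul_assoc]
  | cons a w ih =>
    simp only [cauchy_cons, quot_cauchy, cauchy_nil, cauchy_add_left, cauchy_smul_left,
      Pi.add_apply, Pi.smul_apply, smul_eq_mul, ih, mul_add, mul_assoc, add_assoc]

theorem Proper.cauchy_left {s : Series A K} (hs : Proper s) (r : Series A K) :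
    Proper (cauchy s r) := by
  simp_all [Proper]

theorem Proper.add {s r : Series A K} (hs : Proper s) (hr : Proper r) : Proper (s + r) := by
  simp_all [Proper]

/-- The value of `s · r` at `w` depends only on the values of `r` at shorter words when `s` is
proper. -/
theorem Proper.cauchy_congr {s : Series A K} (hs : Proper s) {r t : Series A K} {w : List A}
    (h : ∀ v : List A, v.length < w.length → r v = t v) : cauchy s r w = cauchy s t w := by
  refine Finset.sum_congr rfl fun i hi => ?_
  rw [Finset.mem_range] at hi
  rcases Nat.eq_zero_or_pos i with rfl | h0
  · have : s [] = 0 := hs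
    simp [this]
  · rw [h]
    rw [List.length_drop]; omega

/-- Uniqueness of the solution of `X = pX + r` for proper `p`. -/
theorem Proper.solution_unique {p r x y : Series A K} (hp : Proper p)
    (hx : x = cauchy p x + r) (hy : y = cauchy p y + r) : x = y := by
  have key : ∀ n, ∀ w : List A, w.length = n → x w = y w := by
    intro n
    induction n using Nat.strong_induction_on with
    | _ n ih =>
      rintro w rfl
      rw [hx, hy, Pi.add_apply, Pi.add_apply,
        hp.cauchy_congr fun v hv => ih _ hv v rfl]
  exact funext fun w => key _ w rfl

end Cauchy

/-! ### Iterations -/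

section Iteration

variable {A K : Type*} [Semiring K]

theorem semPow_succ_eq (F : Series A K → Series A K) (n : ℕ) (s : Series A K) :
    semPow F (n + 1) s = cauchy (F fun _ => 1) (semPow F n s) := by
  induction n generalizing s with
  | zero => rfl
  | succ n ih => rw [semPow, ih, cauchy_assoc]; rfl

/-- By `semPow_succ_eq`, the series is a product of n copies of the proper series `F 1` and one
factor `F s`. Only the n proper factors must each take a letter; `F s` need not be proper. -/
theorem semPow_eq_zero {F : Series A K → Series A K} (hF : Proper (F fun _ => 1)) (s : Series A K)
    (n : ℕ) (w : List A) (h : w.length < n) : semPow F n s w = 0 := by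
  induction n generalizing w with
  | zero => omega
  | succ n ih =>
    rw [semPow_succ_eq, hF.cauchy_congr (t := 0) fun v hv => ih v (by omega)]
    simp [cauchy]

theorem finsum_semPow {F : Series A K → Series A K} (hF : Proper (F fun _ => 1))
    (s : Series A K) {w : List A} {N : ℕ} (h : w.length < N) :
    ∑ᶠ n, semPow F n s w = ∑ n ∈ Finset.range N, semPow F n s w := by
  refine finsum_eq_finsetSum_of_support_subset _ fun n hn => ?_
  by_contra h'
  exact hn (semPow_eq_zero hF s n w (by simp at h'; omega))

/-- The series `T = ∑ₙ ‖⟨ρⁿ⟩φ‖` satisfies `T = ‖⟨ρ⟩true‖ · T + ‖⟨ρ⟩φ‖`. -/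
theorem finsum_semPow_eq {F : Series A K → Series A K} (hF : Proper (F fun _ => 1))
    (s : Series A K) :
    (fun w => ∑ᶠ n, semPow F n s w) =
      cauchy (F fun _ => 1) (fun w => ∑ᶠ n, semPow F n s w) + F s := by
  funext w
  -- Truncating at |w| + 2 leaves |w| + 1 terms once n = 0 is split off. These give the full sum on
  -- all words shorter than w, the only ones seen behind a proper factor.
  rw [finsum_semPow hF s (Nat.lt_succ_of_lt w.length.lt_succ_self), Finset.sum_range_succ',
    Pi.add_apply]
  congr 1
  have h : cauchy (F fun _ => 1) (fun w => ∑ᶠ n, semPow F n s w) w =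
      cauchy (F fun _ => 1) (∑ n ∈ Finset.range (w.length + 1), semPow F n s) w :=
    hF.cauchy_congr fun v hv => by
      rw [finsum_semPow hF s (Nat.lt_succ_of_lt hv), Finset.sum_apply]
  simp only [h, cauchy_sum_right, Finset.sum_apply, semPow_succ_eq]

end Iteration

/-! ### Recognizable series and stable submodules -/

section Stable

variable {A K : Type*} [Semiring K]

/-- A series is finitely stable if it lies in a finitely generated submodule of series which is
closed under the left quotients by letters. -/
def FinitelyStable (s : Series A K) : Prop :=
  ∃ M : Submodule K (Series A K), M.FG ∧ s ∈ M ∧ ∀ t ∈ M, ∀ a, quot a t ∈ M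

theorem FinitelyStable.of_span {s : Series A K} (S : Set (Series A K)) (hS : S.Finite)
    (hs : s ∈ Submodule.span K S) (h : ∀ t ∈ S, ∀ a, quot a t ∈ Submodule.span K S) :
    FinitelyStable s := by
  refine ⟨Submodule.span K S, Submodule.fg_span hS, hs, fun t ht a => ?_⟩
  have : Submodule.span K S ≤ (Submodule.span K S).comap (quot a) :=
    Submodule.span_le.2 fun t ht => h t ht a
  exact this ht

theorem FinitelyStable.const (k : K) : FinitelyStable (fun _ : List A => k) :=
  .of_span {fun _ => k} (Set.finite_singleton _) (Submodule.mem_span_singleton_self _)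
    (by rintro _ rfl a; exact Submodule.mem_span_singleton_self _)

theorem FinitelyStable.add {s r : Series A K} (hs : FinitelyStable s) (hr : FinitelyStable r) :
    FinitelyStable (s + r) := by
  obtain ⟨M, hM, hsM, hMq⟩ := hs
  obtain ⟨N, hN, hrN, hNq⟩ := hr
  refine ⟨M ⊔ N, hM.sup hN, Submodule.add_mem_sup hsM hrN, fun t ht a => ?_⟩
  have : M ⊔ N ≤ (M ⊔ N).comap (quot a) :=
    sup_le (fun y hy => Submodule.mem_sup_left (hMq y hy a))
      (fun y hy => Submodule.mem_sup_right (hNq y hy a))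
  exact this ht

/-- The module M·r + N is stable because a⁻¹(yr) = y(ε)·a⁻¹r + (a⁻¹y)r. -/
theorem FinitelyStable.cauchy {s r : Series A K} (hs : FinitelyStable s) (hr : FinitelyStable r) :
    FinitelyStable (cauchy s r) := by
  obtain ⟨M, hM, hsM, hMq⟩ := hs
  obtain ⟨N, hN, hrN, hNq⟩ := hr
  refine ⟨M.map (cauchyRight r) ⊔ N, (hM.map _).sup hN,
    Submodule.mem_sup_left (Submodule.mem_map_of_mem (f := cauchyRight r) hsM), fun t ht a => ?_⟩
  have : M.map (cauchyRight r) ⊔ N ≤ (M.map (cauchyRight r) ⊔ N).comap (quot a) := by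
    refine sup_le (Submodule.map_le_iff_le_comap.2 fun y hy => ?_)
      (fun y hy => Submodule.mem_sup_right (hNq y hy a))
    simp only [Submodule.mem_comap, cauchyRight_apply, quot_cauchy]
    exact add_mem (Submodule.mem_sup_right (N.smul_mem _ (hNq r hrN a)))
      (Submodule.mem_sup_left (Submodule.mem_map_of_mem (f := cauchyRight r) (hMq y hy a)))
  exact this ht

/-- The solution of `X = pX + r` with `p` proper is finitely stable if `p` and `r` are. -/
theorem FinitelyStable.solution {p r t : Series A K} (hp : FinitelyStable p)
    (hr : FinitelyStable r) (h0 : Proper p) (ht : t = WeightedLDL.cauchy p t + r) :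
    FinitelyStable t := by
  obtain ⟨M, hM, hpM, hMq⟩ := hp
  obtain ⟨N, hN, hrN, hNq⟩ := hr
  have hmem : ∀ y ∈ M, WeightedLDL.cauchy y t ∈ M.map (cauchyRight t) ⊔ N := fun y hy =>
    Submodule.mem_sup_left (Submodule.mem_map_of_mem (f := cauchyRight t) hy)
  -- Since p(ε) = 0, the term p(ε)·a⁻¹t disappears and a⁻¹t = (a⁻¹p)t + a⁻¹r lies in M·t + N.
  have htq : ∀ a, quot a t ∈ M.map (cauchyRight t) ⊔ N := fun a => by
    have h0' : p [] = 0 := h0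
    have := congrArg (quot a) ht
    rw [map_add, quot_cauchy, h0', zero_smul, zero_add] at this
    rw [this]
    exact add_mem (hmem _ (hMq p hpM a)) (Submodule.mem_sup_right (hNq r hrN a))
  refine ⟨M.map (cauchyRight t) ⊔ N, (hM.map _).sup hN, ?_, fun x hx a => ?_⟩
  · have := add_mem (hmem p hpM) (Submodule.mem_sup_right hrN)
    rwa [← ht] at this
  · have : M.map (cauchyRight t) ⊔ N ≤ (M.map (cauchyRight t) ⊔ N).comap (quot a) := by
      refine sup_le (Submodule.map_le_iff_le_comap.2 fun y hy => ?_)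
        (fun y hy => Submodule.mem_sup_right (hNq y hy a))
      simp only [Submodule.mem_comap, cauchyRight_apply, quot_cauchy]
      exact add_mem (Submodule.smul_mem _ _ (htq a)) (hmem _ (hMq y hy a))
    exact this hx

/-- Left quotients are multiplicative for the pointwise product, so M * N is stable. Commutativity
of K enters here: it makes the product of finitely generated modules finitely generated. -/
theorem FinitelyStable.hadamard {A K : Type*} [CommSemiring K] {s r : Series A K}
    (hs : FinitelyStable s) (hr : FinitelyStable r) : FinitelyStable (s * r) := by
  obtain ⟨M, hM, hsM, hMq⟩ := hs
  obtain ⟨N, hN, hrN, hNq⟩ := hr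
  refine ⟨M * N, hM.mul hN, Submodule.mul_mem_mul hsM hrN, fun t ht a => ?_⟩
  have : M * N ≤ (M * N).comap (quot a) := by
    rw [Submodule.mul_le]
    exact fun x hx y hy => Submodule.mul_mem_mul (hMq x hx a) (hNq y hy a)
  exact this ht

/-- The behavior of a weighted automaton started with the state `q`. -/
def WeightedAutomaton.behaviorFrom {Q : Type*} [Fintype Q] (M : WeightedAutomaton A K Q) :
    Q → Series A K
  | q, [] => M.final q
  | q, a :: w => ∑ q', M.wt q a q' * M.behaviorFrom q' w

/-- The initial weights `h` are arbitrary so that induction applies: after a first step from q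
reading a, the weights `M.wt q a` play the role of initial weights for the rest. -/
theorem WeightedAutomaton.sum_paths {Q : Type*} [Fintype Q] (M : WeightedAutomaton A K Q)
    (h : Q → K) (w : List A) :
    (∑ p : Fin (w.length + 1) → Q, h (p 0) *
      (List.ofFn fun i : Fin w.length => M.wt (p i.castSucc) (w.get i) (p i.succ)).prod *
      M.final (p (Fin.last w.length))) = ∑ q, h q * M.behaviorFrom q w := by
  induction w generalizing h with
  | nil =>
    refine ((Equiv.funUnique (Fin 1) Q).symm.sum_comp _).symm.trans ?_
    simp [behaviorFrom]
  | cons a w ih =>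
    refine ((Fin.consEquiv fun _ : Fin (w.length + 2) => Q).sum_comp _).symm.trans ?_
    rw [Fintype.sum_prod_type]
    refine Finset.sum_congr rfl fun q _ => ?_
    simp only [behaviorFrom, ← ih, Finset.mul_sum]
    refine Finset.sum_congr rfl fun p _ => ?_
    simp [Fin.consEquiv, List.ofFn_succ, mul_assoc, ← Fin.succ_last]

theorem WeightedAutomaton.behavior_eq {Q : Type*} [Fintype Q] (M : WeightedAutomaton A K Q) :
    M.behavior = ∑ q, M.init q • M.behaviorFrom q := by
  funext w
  simp only [Finset.sum_apply, Pi.smul_apply, smul_eq_mul]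
  exact M.sum_paths M.init w

/-- The generators serve as states. Transition weights are coefficients, chosen arbitrarily, that
express the quotients of the generators; final weights are the values at ε. -/
theorem FinitelyStable.recognizable {s : Series A K} (hs : FinitelyStable s) :
    Recognizable s := by
  obtain ⟨M, hM, hsM, hMq⟩ := hs
  obtain ⟨n, g, rfl⟩ := Submodule.fg_iff_exists_fin_generating_family.1 hM
  have hg : ∀ i a, ∃ c : Fin n → K, ∑ j, c j • g j = quot a (g i) := fun i a =>
    (Submodule.mem_span_range_iff_exists_fun K).1 (hMq _ (Submodule.subset_span ⟨i, rfl⟩) a)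
  choose c hc using hg
  obtain ⟨α, hα⟩ := (Submodule.mem_span_range_iff_exists_fun K).1 hsM
  let N : WeightedAutomaton A K (Fin n) := ⟨α, fun i a j => c i a j, fun i => g i []⟩
  have hN : ∀ w i, N.behaviorFrom i w = g i w := by
    intro w
    induction w with
    | nil => intro i; rfl
    | cons a w ih =>
      intro i
      have := congrFun (hc i a) w
      simp only [Finset.sum_apply, Pi.smul_apply, smul_eq_mul, quot_apply] at this
      simp only [WeightedAutomaton.behaviorFrom, ih]
      exact this
  refine ⟨n, N, ?_⟩
  rw [N.behavior_eq, ← hα]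
  exact Finset.sum_congr rfl fun i _ => by rw [show N.behaviorFrom i = g i from funext (hN · i)]

end Stable
/-! ### Regular languages -/

section Regular

variable {A : Type*}

theorem isRegular_of_finite {𝓕 : Set (Language A)} (h𝓕 : 𝓕.Finite)
    (hq : ∀ X ∈ 𝓕, ∀ a, X.leftQuotient [a] ∈ 𝓕) {L : Language A} (hL : L ∈ 𝓕) :
    L.IsRegular := by
  refine .of_finite_range_leftQuotient (h𝓕.subset ?_)
  rintro _ ⟨x, rfl⟩
  induction x generalizing L with
  | nil => exact hL
  | cons a x ih =>
    rw [← List.singleton_append, Language.leftQuotient_append]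
    exact ih (hq L hL a)

/-- A regular language lies in a finite family of languages closed under unions and left
quotients. -/
theorem exists_finite_family {L : Language A} (h : L.IsRegular) :
    ∃ 𝓕 : Set (Language A), 𝓕.Finite ∧ L ∈ 𝓕 ∧ 0 ∈ 𝓕 ∧ (∀ X ∈ 𝓕, ∀ Y ∈ 𝓕, X + Y ∈ 𝓕) ∧
      ∀ X ∈ 𝓕, ∀ a, X.leftQuotient [a] ∈ 𝓕 := by
  -- The family consists of all unions of left quotients of L; it is finite by Myhill–Nerode.
  refine ⟨sSup '' (𝒫 (Set.range L.leftQuotient)), h.finite_range_leftQuotient.finite_subsets.image _,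
    ⟨{L}, by simpa using ⟨[], rfl⟩, sSup_singleton⟩, ⟨∅, Set.empty_subset _, sSup_empty⟩, ?_, ?_⟩
  · rintro _ ⟨S, hS, rfl⟩ _ ⟨T, hT, rfl⟩
    exact ⟨S ∪ T, Set.union_subset hS hT, sSup_union⟩
  · rintro _ ⟨S, hS, rfl⟩ a
    refine ⟨(fun X : Language A => X.leftQuotient [a]) '' S, ?_, ?_⟩
    · rintro _ ⟨X, hX, rfl⟩
      obtain ⟨u, rfl⟩ := hS hX
      exact ⟨u ++ [a], Language.leftQuotient_append L u [a]⟩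
    · ext w
      change (∃ Y ∈ (fun X : Language A => X.leftQuotient [a]) '' S, w ∈ Y) ↔ ∃ X ∈ S, [a] ++ w ∈ X
      simp [Language.mem_leftQuotient]

theorem leftQuotient_add (X Y : Language A) (u : List A) :
    (X + Y).leftQuotient u = X.leftQuotient u + Y.leftQuotient u := rfl

theorem mem_leftQuotient_mul (X Y : Language A) (a : A) (w : List A) :
    w ∈ (X * Y).leftQuotient [a] ↔
      w ∈ X.leftQuotient [a] * Y ∨ [] ∈ X ∧ w ∈ Y.leftQuotient [a] := by
  simp only [Language.mem_leftQuotient, Language.mem_mul, List.singleton_append]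
  constructor
  · rintro ⟨u, hu, v, hv, h⟩
    rcases u with _ | ⟨b, u⟩
    · exact .inr ⟨hu, by simpa using h ▸ hv⟩
    · obtain ⟨rfl, rfl⟩ := by simpa using h
      exact .inl ⟨u, hu, v, hv, rfl⟩
  · rintro (⟨u, hu, v, hv, rfl⟩ | ⟨h, hw⟩)
    · exact ⟨a :: u, hu, v, hv, rfl⟩
    · exact ⟨[], h, a :: w, hw, rfl⟩

theorem leftQuotient_mul_of_mem {X : Language A} (h : [] ∈ X) (Y : Language A) (a : A) :
    (X * Y).leftQuotient [a] = X.leftQuotient [a] * Y + Y.leftQuotient [a] := by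
  ext w
  rw [mem_leftQuotient_mul, Language.mem_add, and_iff_right h]

theorem leftQuotient_mul_of_notMem {X : Language A} (h : [] ∉ X) (Y : Language A) (a : A) :
    (X * Y).leftQuotient [a] = X.leftQuotient [a] * Y := by
  ext w
  rw [mem_leftQuotient_mul, or_iff_left fun h' => h h'.1]

/-- The finitely many languages XT + Y are closed under quotients: when ε ∈ X, the extra term a⁻¹T
has the same form and is absorbed by the closure under unions. Taking T = R gives products, T = L*R
gives iterations. -/
theorem isRegular_mul_add {𝓕 𝓖 : Set (Language A)} (h𝓕 : 𝓕.Finite) (h𝓖 : 𝓖.Finite)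
    (h𝓕a : ∀ X ∈ 𝓕, ∀ Y ∈ 𝓕, X + Y ∈ 𝓕) (h𝓖a : ∀ X ∈ 𝓖, ∀ Y ∈ 𝓖, X + Y ∈ 𝓖)
    (h𝓕q : ∀ X ∈ 𝓕, ∀ a, X.leftQuotient [a] ∈ 𝓕) (h𝓖q : ∀ X ∈ 𝓖, ∀ a, X.leftQuotient [a] ∈ 𝓖)
    {T : Language A} (hT : ∀ a, ∃ X ∈ 𝓕, ∃ Y ∈ 𝓖, T.leftQuotient [a] = X * T + Y)
    {X Y : Language A} (hX : X ∈ 𝓕) (hY : Y ∈ 𝓖) : (X * T + Y).IsRegular := by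
  refine isRegular_of_finite (h𝓕.image2 (fun X Y : Language A => X * T + Y) h𝓖) ?_
    (Set.mem_image2_of_mem hX hY)
  rintro _ ⟨X, hX, Y, hY, rfl⟩ a
  by_cases h : [] ∈ X
  · obtain ⟨X', hX', Y', hY', h'⟩ := hT a
    refine ⟨_, h𝓕a _ (h𝓕q X hX a) _ hX', _, h𝓖a _ hY' _ (h𝓖q Y hY a), ?_⟩
    simp only [leftQuotient_add, leftQuotient_mul_of_mem h, h', add_mul, add_assoc]
  · refine ⟨_, h𝓕q X hX a, _, h𝓖q Y hY a, ?_⟩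
    simp only [leftQuotient_add, leftQuotient_mul_of_notMem h]

theorem isRegular_mul {L R : Language A} (hL : L.IsRegular) (hR : R.IsRegular) :
    (L * R).IsRegular := by
  obtain ⟨𝓕, h𝓕, hL𝓕, h0, h𝓕a, h𝓕q⟩ := exists_finite_family hL
  obtain ⟨𝓖, h𝓖, hR𝓖, h0', h𝓖a, h𝓖q⟩ := exists_finite_family hR
  have := isRegular_mul_add h𝓕 h𝓖 h𝓕a h𝓖a h𝓕q h𝓖q (T := R)
    (fun a => ⟨0, h0, _, h𝓖q R hR𝓖 a, by simp⟩) hL𝓕 h0'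
  rwa [add_zero] at this

theorem kstar_mul_eq (L R : Language A) : KStar.kstar L * R = L * (KStar.kstar L * R) + R := by
  conv_lhs => rw [← Language.one_add_self_mul_kstar_eq_kstar, add_mul, one_mul, mul_assoc, add_comm]

/-- As ε ∉ L, the equation T = LT + R for T = L*R yields a⁻¹T = (a⁻¹L)T + a⁻¹R, the form needed in
`isRegular_mul_add`. -/
theorem isRegular_kstar_mul {L R : Language A} (hL : L.IsRegular) (hR : R.IsRegular)
    (h : [] ∉ L) : (KStar.kstar L * R).IsRegular := by
  obtain ⟨𝓕, h𝓕, hL𝓕, h0, h𝓕a, h𝓕q⟩ := exists_finite_family hL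
  obtain ⟨𝓖, h𝓖, hR𝓖, h0', h𝓖a, h𝓖q⟩ := exists_finite_family hR
  have := isRegular_mul_add h𝓕 h𝓖 h𝓕a h𝓖a h𝓕q h𝓖q (T := KStar.kstar L * R)
    (fun a => ⟨_, h𝓕q L hL𝓕 a, _, h𝓖q R hR𝓖 a, by
      conv_lhs => rw [kstar_mul_eq, leftQuotient_add, leftQuotient_mul_of_notMem h]⟩) hL𝓕 hR𝓖
  rwa [← kstar_mul_eq] at this

theorem append_mem_kstar_mul {L R : Language A} {u v : List A} (hu : u ∈ L)
    (hv : v ∈ KStar.kstar L * R) : u ++ v ∈ KStar.kstar L * R := by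
  rw [kstar_mul_eq]
  exact Or.inl ⟨u, hu, v, hv, rfl⟩

theorem mem_kstar_mul {L R : Language A} {w : List A} (hw : w ∈ R) : w ∈ KStar.kstar L * R := by
  rw [kstar_mul_eq]
  exact Or.inr hw

theorem kstar_mul_induction {L R : Language A} {C : List A → Prop} (base : ∀ w ∈ R, C w)
    (step : ∀ u ∈ L, ∀ v, C v → C (u ++ v)) : ∀ w ∈ KStar.kstar L * R, C w := by
  rintro _ ⟨x, hx, v, hv, rfl⟩
  obtain ⟨S, rfl, hS⟩ := Language.mem_kstar.1 hx
  clear hx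
  induction S with
  | nil => exact base v hv
  | cons u S ih =>
    have := step u (hS u (by simp)) _ (ih fun y hy => hS y (by simp [hy]))
    simpa using this

/-- Adjoining L to a finite quotient-closed family containing M and 0 keeps it closed. -/
theorem isRegular_of_leftQuotient {L M : Language A} (hM : M.IsRegular)
    (h : ∀ a, L.leftQuotient [a] = M ∨ L.leftQuotient [a] = 0) : L.IsRegular := by
  obtain ⟨𝓕, h𝓕, hM𝓕, h0, -, h𝓕q⟩ := exists_finite_family hM
  refine isRegular_of_finite (h𝓕.insert L) ?_ (Set.mem_insert L 𝓕)
  rintro X (rfl | hX) a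
  · rcases h a with h | h <;> rw [h]
    · exact .inr hM𝓕
    · exact .inr h0
  · exact .inr (h𝓕q X hX a)

theorem isRegular_univ : Language.IsRegular (fun _ => True : Language A) :=
  isRegular_of_finite (Set.finite_singleton _) (by rintro _ rfl a; rfl) rfl

theorem isRegular_ne_nil : Language.IsRegular {w : List A | w ≠ []} :=
  isRegular_of_leftQuotient isRegular_univ fun a => .inl <| by
    ext w; change _ ≠ _ ↔ True; simp

theorem isRegular_one : (1 : Language A).IsRegular :=
  isRegular_of_leftQuotient isRegular_univ fun a => .inr <| by
    ext w; simp [Language.mem_leftQuotient, Language.mem_one]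

theorem isRegular_two_le : Language.IsRegular {w : List A | 2 ≤ w.length} :=
  isRegular_of_leftQuotient isRegular_ne_nil fun a => .inl <| by
    ext w
    change 2 ≤ (a :: w).length ↔ w ≠ []
    rw [List.length_cons, Nat.succ_le_succ_iff, Nat.one_le_iff_ne_zero, List.length_eq_zero_iff.ne]

end Regular

/-! ### The languages of LDL formulas are regular -/

section LDLRegular

variable {A : Type*}

theorem satPow_succ_iff (F : (List A → Prop) → List A → Prop) (n : ℕ) (P : List A → Prop)
    (w : List A) : satPow F (n + 1) P w ↔
      ∃ u v, w = u ++ v ∧ F (fun _ => True) u ∧ satPow F n P v := by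
  induction n generalizing w P with
  | zero => rfl
  | succ n ih =>
    constructor
    · rintro ⟨_, z, rfl, h, hz⟩
      obtain ⟨x, y, rfl, hx, hy⟩ := (ih _ _).1 h
      exact ⟨x, y ++ z, by simp, hx, y, z, rfl, hy, hz⟩
    · rintro ⟨x, _, rfl, hx, y, z, rfl, hy, hz⟩
      exact ⟨x ++ y, z, by simp, (ih _ _).2 ⟨x, y, rfl, hx, hy⟩, hz⟩

/-- The language of `⟨θ⁺⟩ψ` in terms of the languages `L₁` of `⟨θ⟩true` and `L` of `⟨θ⟩ψ`: with
`N = L₁ ∖ {ε}` it is `N*(L ∖ {ε})`, together with the words of `N*` having a factorization with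
a long factor if `ε ∈ L`. -/
theorem satPow_bounded_iff (F : (List A → Prop) → List A → Prop) (P : List A → Prop)
    {N L N₂ : Language A} (hN : ∀ w, w ∈ N ↔ F (fun _ => True) w ∧ w ≠ [])
    (hL : ∀ w, w ∈ L ↔ F P w ∧ w ≠ [])
    (hN₂ : ∀ w, w ∈ N₂ ↔ F (fun _ => True) w ∧ 2 ≤ w.length) (w : List A) :
    (∃ n, n + 1 ≤ w.length ∧ satPow F n P w) ↔
      w ∈ KStar.kstar N * L ∨ F P [] ∧ w ∈ KStar.kstar N * (N₂ * (KStar.kstar N * 1)) := by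
  have step : ∀ u ∈ N, ∀ v, (∃ n, n + 1 ≤ v.length ∧ satPow F n P v) →
      ∃ n, n + 1 ≤ (u ++ v).length ∧ satPow F n P (u ++ v) := by
    rintro u hu v ⟨n, hn, h⟩
    obtain ⟨hu, hu'⟩ := (hN u).1 hu
    have := List.length_pos_iff.2 hu'
    exact ⟨n + 1, by simp; omega, (satPow_succ_iff F n P _).2 ⟨u, v, rfl, hu, h⟩⟩
  constructor
  · rintro ⟨n, hn, h⟩
    -- Empty factors are discarded. If the last factor is empty too, then either some factor has
    -- length at least 2, or all nonempty factors are letters and |w| ≤ n, which the bound n + 1 ≤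
    -- |w| excludes.
    have key : ∀ n w, satPow F n P w → w ∈ KStar.kstar N * L ∨ F P [] ∧
        (w ∈ KStar.kstar N * (N₂ * (KStar.kstar N * 1)) ∨
          w ∈ KStar.kstar N * 1 ∧ w.length ≤ n) := by
      intro n
      induction n with
      | zero =>
        intro w hw
        by_cases h0 : w = []
        · subst h0
          exact .inr ⟨hw, .inr ⟨mem_kstar_mul rfl, by simp⟩⟩
        · exact .inl (mem_kstar_mul ((hL w).2 ⟨hw, h0⟩))
      | succ n ih =>
        intro w hw
        obtain ⟨u, v, rfl, hu, hv⟩ := (satPow_succ_iff F n P w).1 hw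
        by_cases h0 : u = []
        · subst h0
          rcases ih v hv with h | ⟨h, h' | ⟨h', h''⟩⟩
          · exact .inl h
          · exact .inr ⟨h, .inl h'⟩
          · exact .inr ⟨h, .inr ⟨h', by simp; omega⟩⟩
        · have huN := (hN u).2 ⟨hu, h0⟩
          rcases ih v hv with h | ⟨h, h' | ⟨h', h''⟩⟩
          · exact .inl (append_mem_kstar_mul huN h)
          · exact .inr ⟨h, .inl (append_mem_kstar_mul huN h')⟩
          · by_cases h2 : 2 ≤ u.length
            · exact .inr ⟨h, .inl (mem_kstar_mul ⟨u, (hN₂ u).2 ⟨hu, h2⟩, v, h', rfl⟩)⟩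
            · exact .inr ⟨h, .inr ⟨append_mem_kstar_mul huN h', by simp; omega⟩⟩
    rcases key n w h with h | ⟨h, h' | ⟨-, h'⟩⟩
    · exact .inl h
    · exact .inr ⟨h, h'⟩
    · omega
  · rintro (h | ⟨h0, h⟩)
    · refine kstar_mul_induction (fun w hw => ?_) step w h
      obtain ⟨hw, hw'⟩ := (hL w).1 hw
      exact ⟨0, List.length_pos_iff.2 hw', hw⟩
    · refine kstar_mul_induction (fun w hw => ?_) step w h
      obtain ⟨u, hu, v, hv, rfl⟩ := hw
      obtain ⟨hu, hu'⟩ := (hN₂ u).1 hu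
      -- The empty last factor costs one unit, so only m ≤ |v| is available. The factor u, of length
      -- at least 2, makes up for it.
      obtain ⟨m, hm, h⟩ : ∃ m, m ≤ v.length ∧ satPow F m P v := by
        refine kstar_mul_induction (C := fun v => ∃ m, m ≤ v.length ∧ satPow F m P v)
          (fun w hw => ?_) ?_ v hv
        · obtain rfl : w = [] := hw
          exact ⟨0, le_rfl, h0⟩
        · rintro u hu v ⟨n, hn, h⟩
          obtain ⟨hu, hu'⟩ := (hN u).1 hu
          have := List.length_pos_iff.2 hu'
          exact ⟨n + 1, by simp; omega, (satPow_succ_iff F n P _).2 ⟨u, v, rfl, hu, h⟩⟩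
      exact ⟨m + 1, by simp; omega, (satPow_succ_iff F m P _).2 ⟨u, v, rfl, hu, h⟩⟩

theorem isRegular_satPow_bounded (F : (List A → Prop) → List A → Prop) (P : List A → Prop)
    (h1 : Language.IsRegular {w | F (fun _ => True) w}) (hP : Language.IsRegular {w | F P w}) :
    Language.IsRegular {w | ∃ n, n + 1 ≤ w.length ∧ satPow F n P w} := by
  have hN := h1.inf isRegular_ne_nil
  have hV := isRegular_kstar_mul hN (hP.inf isRegular_ne_nil) (fun h => h.2 rfl)
  have hZ := isRegular_kstar_mul hN
    (isRegular_mul (h1.inf isRegular_two_le) (isRegular_kstar_mul hN isRegular_one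
      (fun h => h.2 rfl))) (fun h => h.2 rfl)
  have key := satPow_bounded_iff F P (fun w => Iff.rfl) (fun w => Iff.rfl) (fun w => Iff.rfl)
  -- Membership of ε is a fixed truth value, so the second part of the language is either present as
  -- a whole or absent.
  by_cases h0 : F P []
  · refine (congrArg Language.IsRegular ?_).mpr (hV.add hZ)
    ext w
    exact (key w).trans (by simp only [h0, true_and]; rfl)
  · refine (congrArg Language.IsRegular ?_).mpr hV
    ext w
    exact (key w).trans (by simp only [h0, false_and, or_false]; rfl)

theorem PropFormula.sat_cons (φ : PropFormula A) (a : A) (w : List A) :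
    φ.Sat (a :: w) ↔ φ.Sat [a] := by
  induction φ with
  | tt => rfl
  | atom b => simp [Sat]
  | neg φ ih => simp [Sat, ih]
  | and φ₁ φ₂ ih₁ ih₂ => simp [Sat, ih₁, ih₂]

mutual

theorem LDL.isRegular : ∀ ψ : LDL A, Language.IsRegular {w | ψ.Sat w}
  | .tt => isRegular_univ
  | .atom a => isRegular_of_leftQuotient isRegular_univ fun b => by
      by_cases h : b = a
      · refine .inl ?_
        ext w
        change (b :: w).head? = some a ↔ True
        simp [h]
      · refine .inr ?_
        ext w
        change (b :: w).head? = some a ↔ False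
        simp [h]
  | .neg ψ => (LDL.isRegular ψ).compl
  | .and ψ₁ ψ₂ => (LDL.isRegular ψ₁).inf (LDL.isRegular ψ₂)
  | .dia θ ψ => LDLPath.isRegular θ ψ.Sat (LDL.isRegular ψ)

/-- P ranges over all regular languages because θ acts as an operator: `seq` and `iter` apply it to
`true` as well as to the given P. -/
theorem LDLPath.isRegular : ∀ (θ : LDLPath A) (P : List A → Prop),
    Language.IsRegular {w | P w} → Language.IsRegular {w | θ.Sat P w}
  | .prop φ, P, hP => isRegular_of_leftQuotient hP fun a => by
      by_cases h : φ.Sat [a]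
      · refine .inl ?_
        ext w
        change (φ.Sat (a :: w) ∧ ∃ b v, a :: w = b :: v ∧ P v) ↔ P w
        simp [φ.sat_cons, h]
      · refine .inr ?_
        ext w
        change (φ.Sat (a :: w) ∧ ∃ b v, a :: w = b :: v ∧ P v) ↔ False
        simp [φ.sat_cons, h]
  | .test ψ, _, hP => (LDL.isRegular ψ).inf hP
  | .plus θ₁ θ₂, P, hP => (LDLPath.isRegular θ₁ P hP).add (LDLPath.isRegular θ₂ P hP)
  | .seq θ₁ θ₂, P, hP => by
      refine (congrArg Language.IsRegular ?_).mpr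
        (isRegular_mul (LDLPath.isRegular θ₁ _ isRegular_univ) (LDLPath.isRegular θ₂ P hP))
      ext w
      change (∃ u v, w = u ++ v ∧ θ₁.Sat (fun _ => True) u ∧ θ₂.Sat P v) ↔
        ∃ u, θ₁.Sat (fun _ => True) u ∧ ∃ v, θ₂.Sat P v ∧ u ++ v = w
      grind
  | .iter θ, P, hP => isRegular_satPow_bounded θ.Sat P (LDLPath.isRegular θ _ isRegular_univ)
      (LDLPath.isRegular θ P hP)

end

theorem FinitelyStable.charSeries {K : Type*} [Semiring K] {L : Language A} (h : L.IsRegular) :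
    FinitelyStable (charSeries K (L : Set (List A))) := by
  refine .of_span ((fun X : Language A => WeightedLDL.charSeries K (X : Set (List A))) ''
    Set.range L.leftQuotient) (h.finite_range_leftQuotient.image _)
    (Submodule.subset_span ⟨L, ⟨[], rfl⟩, rfl⟩) ?_
  rintro _ ⟨_, ⟨u, rfl⟩, rfl⟩ a
  exact Submodule.subset_span ⟨_, ⟨u ++ [a], Language.leftQuotient_append L u [a]⟩, rfl⟩

end LDLRegular
/-! ### Definable series are recognizable -/

section Definable

/-- This serves ⟨φ⟩ with φ propositional: φ sees only the first letter, so the quotients of the new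
series are scalar multiples of the old one. -/
theorem FinitelyStable.of_quot_mem_span {A K : Type*} [Semiring K] {s t : Series A K}
    (hs : FinitelyStable s) (h : ∀ a, quot a t ∈ Submodule.span K {s}) : FinitelyStable t := by
  obtain ⟨M, hM, hsM, hMq⟩ := hs
  refine ⟨M ⊔ Submodule.span K {t}, hM.sup (Submodule.fg_span (Set.finite_singleton t)),
    Submodule.mem_sup_right (Submodule.mem_span_singleton_self t), fun x hx a => ?_⟩
  have : M ⊔ Submodule.span K {t} ≤ (M ⊔ Submodule.span K {t}).comap (quot a) := by
    refine sup_le (fun y hy => Submodule.mem_sup_left (hMq y hy a)) (Submodule.span_le.2 ?_)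
    rintro _ rfl
    exact Submodule.mem_sup_left (Submodule.span_le.2 (by simpa using hsM) (h a))
  exact this hx

variable {A K : Type*} [CommSemiring K]

mutual

theorem WLDL.finitelyStable : ∀ φ : WLDL A K, φ.Defined → FinitelyStable φ.sem
  | .const k, _ => .const k
  | .ldl ψ, _ => .charSeries ψ.isRegular
  | .add φ₁ φ₂, h => (WLDL.finitelyStable φ₁ h.1).add (WLDL.finitelyStable φ₂ h.2)
  | .mul φ₁ φ₂, h => (WLDL.finitelyStable φ₁ h.1).hadamard (WLDL.finitelyStable φ₂ h.2)
  | .dia ρ φ, h => WLDLPath.finitelyStable ρ h.1 φ.sem (WLDL.finitelyStable φ h.2)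

theorem WLDLPath.finitelyStable : ∀ ρ : WLDLPath A K, ρ.Defined → ∀ s : Series A K,
    FinitelyStable s → FinitelyStable (ρ.sem s)
  | .prop φ, _, s, hs => hs.of_quot_mem_span fun a => by
      refine Submodule.mem_span_singleton.2 ⟨WeightedLDL.charSeries K {w | φ.Sat w} [a], ?_⟩
      funext w
      have : WeightedLDL.charSeries K {w | φ.Sat w} (a :: w) =
          WeightedLDL.charSeries K {w | φ.Sat w} [a] := by
        by_cases h : φ.Sat [a] <;>
          simp [WeightedLDL.charSeries, Set.indicator, φ.sat_cons a w, h]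
      simp [WLDLPath.sem, this]
  | .test φ, h, _, hs => (WLDL.finitelyStable φ h).hadamard hs
  | .add ρ₁ ρ₂, h, s, hs =>
      (WLDLPath.finitelyStable ρ₁ h.1 s hs).add (WLDLPath.finitelyStable ρ₂ h.2 s hs)
  | .mul ρ₁ ρ₂, h, s, hs =>
      (WLDLPath.finitelyStable ρ₁ h.1 _ (.const 1)).cauchy (WLDLPath.finitelyStable ρ₂ h.2 s hs)
  | .iter ρ, h, s, hs => by
      have hp : Proper (ρ.sem fun _ => 1) := by
        have := h.2
        rwa [WLDL.sem, WLDL.sem_true] at this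
      exact (WLDLPath.finitelyStable ρ h.1 _ (.const 1)).solution
        (WLDLPath.finitelyStable ρ h.1 s hs) hp (finsum_semPow_eq hp s)

end

end Definable

/-! ### Recognizable series are definable -/

section Recognizable

variable {A K : Type*} [Semiring K]

theorem LDLDefinable.const (k : K) : LDLDefinable (fun _ : List A => k) :=
  ⟨.const k, trivial, rfl⟩

theorem LDLDefinable.add {s r : Series A K} (hs : LDLDefinable s) (hr : LDLDefinable r) :
    LDLDefinable (s + r) := by
  obtain ⟨φ, hφ, rfl⟩ := hs
  obtain ⟨χ, hχ, rfl⟩ := hr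
  exact ⟨.add φ χ, ⟨hφ, hχ⟩, rfl⟩

theorem LDLDefinable.smul (k : K) {s : Series A K} (hs : LDLDefinable s) :
    LDLDefinable (k • s) := by
  obtain ⟨φ, hφ, rfl⟩ := hs
  exact ⟨.mul (.const k) φ, ⟨trivial, hφ⟩, rfl⟩

theorem LDLDefinable.sum {ι : Type*} (S : Finset ι) {s : ι → Series A K}
    (hs : ∀ i, LDLDefinable (s i)) : LDLDefinable (∑ i ∈ S, s i) := by
  classical
  induction S using Finset.induction_on with
  | empty => simpa using! LDLDefinable.const (A := A) (0 : K)
  | insert i S hi ih => rw [Finset.sum_insert hi]; exact (hs i).add ih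

/-- Tests turn any formula into a path expression with the same series, which makes Cauchy products
and iterations of definable series expressible. -/
theorem WLDLPath.sem_test_one (φ : WLDL A K) : WLDLPath.sem (.test φ) (fun _ => 1) = φ.sem := by
  funext w
  simp [WLDLPath.sem]

theorem LDLDefinable.cauchy {s r : Series A K} (hs : LDLDefinable s) (hr : LDLDefinable r) :
    LDLDefinable (cauchy s r) := by
  obtain ⟨φ, hφ, rfl⟩ := hs
  obtain ⟨χ, hχ, rfl⟩ := hr
  refine ⟨.dia (.mul (.test φ) (.test χ)) (.ldl .tt), ⟨⟨hφ, hχ⟩, trivial⟩, ?_⟩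
  rw [WLDL.sem, WLDL.sem_true]
  exact (congrArg₂ WeightedLDL.cauchy (WLDLPath.sem_test_one φ) (WLDLPath.sem_test_one χ)).symm

/-- The iteration `q = ∑_{n ≥ 1} pⁿ` of a definable proper series is definable. -/
theorem LDLDefinable.exists_iteration {p : Series A K} (hp : LDLDefinable p) (h0 : Proper p) :
    ∃ q : Series A K, LDLDefinable q ∧ q = WeightedLDL.cauchy p q + p := by
  obtain ⟨φ, hφ, rfl⟩ := hp
  have hF := WLDLPath.sem_test_one φ
  refine ⟨WLDLPath.sem (.iter (.test φ)) fun _ => 1,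
    ⟨.dia (.iter (.test φ)) (.ldl .tt), ⟨⟨hφ, ?_⟩, trivial⟩, ?_⟩, ?_⟩
  · rwa [WLDL.sem, WLDL.sem_true, hF]
  · rw [WLDL.sem, WLDL.sem_true]
  · have := finsum_semPow_eq (F := WLDLPath.sem (.test φ)) (by rwa [hF]) fun _ => 1
    rw [hF] at this
    exact this

/-- The components of the solution of a linear system with definable coefficients and proper
matrix are definable. -/
theorem LDLDefinable.of_linear_system (n : ℕ) (P : Fin n → Fin n → Series A K)
    (r x : Fin n → Series A K) (hP : ∀ i j, LDLDefinable (P i j)) (h0 : ∀ i j, Proper (P i j))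
    (hr : ∀ i, LDLDefinable (r i))
    (hx : ∀ i, x i = ∑ j, WeightedLDL.cauchy (P i j) (x j) + r i) (i : Fin n) :
    LDLDefinable (x i) := by
  induction n with
  | zero => exact i.elim0
  | succ n ih =>
    -- Gaussian elimination of x₀. Iteration starts at n = 1, so q plays the role of p⁺ for p = P₀₀,
    -- and p* is written 1 + q throughout.
    obtain ⟨q, hq, hqe⟩ := (hP 0 0).exists_iteration (h0 0 0)
    obtain ⟨y, hy⟩ : ∃ y, y = ∑ j : Fin n, WeightedLDL.cauchy (P 0 j.succ) (x j.succ) + r 0 :=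
      ⟨_, rfl⟩
    have hx0 : x 0 = y + WeightedLDL.cauchy q y := by
      refine (h0 0 0).solution_unique (r := y) ?_ ?_
      · conv_lhs => rw [hx 0, Fin.sum_univ_succ, add_assoc, ← hy]
      · conv_lhs => rw [hqe]
        rw [cauchy_add_right, cauchy_add_left, cauchy_assoc]
        abel
    -- Substituting x₀ = (1 + q)y into row i gives Pᵢ₀x₀ = gᵢy with gᵢ = Pᵢ₀(1 + q), again proper,
    -- so the reduced system satisfies the same hypotheses.
    let g : Fin n → Series A K := fun i => P i.succ 0 + WeightedLDL.cauchy (P i.succ 0) q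
    have hg : ∀ i, LDLDefinable (g i) := fun i => (hP _ _).add ((hP _ _).cauchy hq)
    have hg0 : ∀ i, Proper (g i) := fun i => (h0 _ _).add ((h0 _ _).cauchy_left q)
    have hsucc : ∀ i : Fin n, LDLDefinable (x i.succ) := by
      refine ih (fun i j => P i.succ j.succ + WeightedLDL.cauchy (g i) (P 0 j.succ))
        (fun i => WeightedLDL.cauchy (g i) (r 0) + r i.succ) (fun i => x i.succ)
        (fun i j => (hP _ _).add ((hg i).cauchy (hP _ _)))
        (fun i j => (h0 _ _).add ((hg0 i).cauchy_left _))
        (fun i => ((hg i).cauchy (hr 0)).add (hr _)) fun i => ?_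
      have hgy : WeightedLDL.cauchy (P i.succ 0) (x 0) = WeightedLDL.cauchy (g i) y := by
        rw [hx0, cauchy_add_right, cauchy_add_left, cauchy_assoc]
      conv_lhs => rw [hx i.succ, Fin.sum_univ_succ, hgy, hy, cauchy_add_right, cauchy_sum_right]
      simp only [cauchy_add_left, Finset.sum_add_distrib, cauchy_assoc]
      abel
    refine Fin.cases ?_ hsucc i
    have hyd : LDLDefinable y := hy ▸
      (LDLDefinable.sum _ fun j => (hP 0 (Fin.succ j)).cauchy (hsucc j)).add (hr 0)
    rw [hx0]
    exact hyd.add (hq.cauchy hyd)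

/-- The series with value `k` at the empty word and `0` elsewhere. -/
def emptySeries (k : K) : Series A K
  | [] => k
  | _ :: _ => 0

/-- The series with value `c a` at the one-letter word `a` and `0` at all other words. -/
def letterSeries (c : A → K) : Series A K
  | [a] => c a
  | _ => 0

theorem emptySeries_cauchy (k : K) (s : Series A K) : cauchy (emptySeries k) s = k • s := by
  funext w
  cases w with
  | nil => simp [emptySeries]
  | cons a w =>
    have : quot a (emptySeries k) = (0 : Series A K) := rfl
    rw [cauchy_cons, this]
    simp [emptySeries, cauchy]

theorem quot_letterSeries (c : A → K) (a : A) : quot a (letterSeries c) = emptySeries (c a) := by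
  funext w
  cases w <;> rfl

/-- The diamond over `true` must consume a letter. -/
theorem LDL.sat_not_dia_true (w : List A) :
    (LDL.neg (.dia (.prop .tt) .tt) : LDL A).Sat w ↔ w = [] := by
  cases w <;> simp [LDL.Sat, LDLPath.Sat, PropFormula.Sat]

theorem LDL.sat_letter (a : A) (w : List A) :
    (LDL.dia (.prop (.atom a)) (.neg (.dia (.prop .tt) .tt))).Sat w ↔ w = [a] := by
  rcases w with _ | ⟨b, _ | ⟨c, w⟩⟩ <;> simp [LDL.Sat, LDLPath.Sat, PropFormula.Sat]

theorem LDLDefinable.emptySeries (k : K) : LDLDefinable (emptySeries k : Series A K) := by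
  refine ⟨.mul (.const k) (.ldl (.neg (.dia (.prop .tt) .tt))), ⟨trivial, trivial⟩, ?_⟩
  funext w
  simp only [WLDL.sem, LDL.sat_not_dia_true, charSeries]
  cases w <;> simp [WeightedLDL.emptySeries]

theorem LDLDefinable.letterSeries [Finite A] (c : A → K) : LDLDefinable (letterSeries c) := by
  classical
  have := Fintype.ofFinite A
  have h : WeightedLDL.letterSeries c =
      ∑ a, c a • charSeries K {w | (LDL.dia (.prop (.atom a)) (.neg (.dia (.prop .tt) .tt))).Sat w} := by
    funext w
    simp only [LDL.sat_letter, charSeries, Finset.sum_apply, Pi.smul_apply, smul_eq_mul]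
    match w with
    | [] => simp [WeightedLDL.letterSeries]
    | [a] => simp [WeightedLDL.letterSeries, Set.indicator]
    | a :: b :: w => simp [WeightedLDL.letterSeries]
  rw [h]
  exact .sum _ fun a => .smul _ ⟨.ldl _, trivial, rfl⟩

/-- Splitting off the first transition gives a linear system whose coefficients live on one-letter
words and hence are proper. -/
theorem WeightedAutomaton.behaviorFrom_eq {Q : Type*} [Fintype Q] (M : WeightedAutomaton A K Q)
    (q : Q) : M.behaviorFrom q =
      ∑ q', cauchy (letterSeries fun a => M.wt q a q') (M.behaviorFrom q') +
        emptySeries (M.final q) := by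
  funext w
  cases w with
  | nil => simp [behaviorFrom, letterSeries, emptySeries]
  | cons a w =>
    simp [behaviorFrom, letterSeries, emptySeries, cauchy_cons, quot_letterSeries,
      emptySeries_cauchy]

theorem Recognizable.ldlDefinable [Finite A] {s : Series A K} (hs : Recognizable s) :
    LDLDefinable s := by
  obtain ⟨n, M, rfl⟩ := hs
  rw [M.behavior_eq]
  exact .sum _ fun q => .smul _ <| .of_linear_system n _ _ _ (fun _ _ => .letterSeries _)
    (fun _ _ => rfl) (fun _ => .emptySeries _) M.behaviorFrom_eq q

end Recognizable
end WeightedLDL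

theorem mainTheorem2 {K : Type*} [CommSemiring K] {A : Type*} [Finite A] [Nonempty A]
    (s : WeightedLDL.Series A K) :
    WeightedLDL.LDLDefinable s ↔ WeightedLDL.Recognizable s := by
  refine ⟨?_, WeightedLDL.Recognizable.ldlDefinable⟩
  rintro ⟨φ, hφ, rfl⟩
  exact (φ.finitelyStable hφ).recognizable
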